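/- A network $\mathcal N$ consists of a finite directed acyclic multigraph $G=(\mathcal V,\mathcal E)$, distinct source nodes $\sigma_1,\dots,\sigma_s\in\mathcal V$ and a receiver $\rho\in\mathcal V$ that is not a source, such that every node has a directed path to $\rho$ and every node without in-edges is a source. Let $\mathcal A$ be a finite alphabet with $|\mathcal A|\ge 2$ and let $f:\mathcal A^s\to\mathcal B$ be a target function that depends on each of its $s$ arguments. For positive integers $k,n$, a $(k,n)$ network code assigns to every edge $e$ leaving a node $v$ an encoding function that maps the vectors in $\mathcal A^n$ carried by the in-edges of $v$ (together with the message vector in $\mathcal A^k$ of $v$, if $v$ is a source) to the vector in $\mathcal A^n$ carried by $e$; it also has a decoding function that maps the vectors on the in-edges of $\rho$ to $\mathcal B^k$. It is a solution if, for all message vectors $\alpha(\sigma_1),\dots,\alpha(\sigma_s)\in\mathcal A^k$ and all $j\in\{1,\dots,k\}$, the $j$-th component of the decoded vector is $f(\alpha(\sigma_1)_j,\dots,\alpha(\sigma_s)_j)$. The computing capacity is $$\mathcal C_{\rm cod}(\mathcal N,f)=\sup\{k/n:\text{ a }(k,n)\text{ solution for computing } f \text{ in }\mathcal N\text{ exists}\}.$$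 A set $C\subseteq\mathcal E$ separates $\sigma_i$ from $\rho$ if every directed path from $\sigma_i$ to $\rho$ contains an edge of $C$. Let $I_C$ be the set of all $i$ such that $C$ separates $\sigma_i$ from $\rho$; $C$ is a cut if $I_C\neq\emptyset$, and $\Lambda(\mathcal N)$ is the set of cuts. For $I\subseteq\{1,\dots,s\}$ and $a,b\in\mathcal A^{I}$, write $a\equiv b$ if $f(x)=f(y)$ for all $x,y\in\mathcal A^s$ with $x_I=a$, $y_I=b$ and $x_j=y_j$ for all $j\notin I$. This is an equivalence relation; let $R_{I,f}$ be the number of its classes, and put $R_{C,f}=R_{I_C,f}$. A Steiner tree of $\mathcal N$ is a minimal (with respect to inclusion of nodes and edges) subgraph of $G$ that contains all the sources and $\rho$ and in which every source has a directed path to $\rho$. Let $\mathcal T(\mathcal N)$ be the set of Steiner trees. The fractional Steiner tree packing number is the value of the linear program $$\Pi(\mathcal N)=\max\sum_{t\in\mathcal T(\mathcal N)}u_t\quad\text{subject to}\quad u_t\ge 0\ \ (t\in\mathcal T(\mathcal N)),\qquad \sum_{t\in\mathcal T(\mathcal N):\ e\in\mathcal E(t)}u_t\le 1\ \ (e\in\mathcal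 E).$$ **Theorem.** For every network $\mathcal N$, alphabet $\mathcal A$ and target function $f$ as above, $$\mathcal C_{\rm cod}(\mathcal N,f)\ \ge\ \Pi(\mathcal N)\cdot\min_{C\in\Lambda(\mathcal N)}\frac{1}{\log_{|\mathcal A|}R_{C,f}}.$$ -/

import Mathlib

/-- `IsDirPath src tgt u v p`: the list of edges `p` is a directed path from `u` to `v` in the
directed multigraph with edge tails `src` and edge heads `tgt`. -/
inductive IsDirPath {V E : Type*} (src tgt : E → V) : V → V → List E → Prop
  | nil (v : V) : IsDirPath src tgt v v []
  | cons (e : E) {w : V} {p : List E} (h : IsDirPath src tgt (tgt e) w p) :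
      IsDirPath src tgt (src e) w (e :: p)

/-- A network: a directed acyclic multigraph with nodes `V` and edges `E` (both are assumed finite
wherever it matters), distinct source nodes `σ₁, …, σₛ`, and a receiver that is not a source. Every
node has a directed path to the receiver, and every node without in-edges is a source. -/
structure Network (V E : Type*) where
  /-- the tail of an edge -/
  src : E → V
  /-- the head of an edge -/
  tgt : E → V
  /-- the number of sources -/
  numSources : ℕ
  /-- the source nodes -/
  source : Fin numSources → V
  source_injective : Function.Injective source
  /-- the receiver -/
  receiver : V
  source_ne_receiver : ∀ i, source i ≠ receiver
  acyclic : ∀ (v : V) (p : List E), IsDirPath src tgt v v p → p = []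
  reaches_receiver : ∀ v : V, ∃ p : List E, IsDirPath src tgt v receiver p
  source_of_no_inEdge : ∀ v : V, (∀ e : E, tgt e ≠ v) → ∃ i, source i = v

theorem IsDirPath.append {V E : Type*} {src tgt : E → V} {u v w : V} {p q : List E}
    (hp : IsDirPath src tgt u v p) (hq : IsDirPath src tgt v w q) :
    IsDirPath src tgt u w (p ++ q) := by
  induction hp with
  | nil v => exact hq
  | cons e h ih => exact IsDirPath.cons e (ih hq)

namespace Network

/-- The in-edges of a node. -/
abbrev InEdge {V E : Type*} (N : Network V E) (v : V) : Type _ := {e : E // N.tgt e = v}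

/-- By acyclicity, edge vectors can be computed by recursion along "head of `e'` = tail of `e`". -/
theorem wellFounded_edge {V E : Type*} [Finite E] (N : Network V E) :
    WellFounded (fun e' e : E => N.tgt e' = N.src e) := by
  have key : ∀ e' e : E, Relation.TransGen (fun e' e : E => N.tgt e' = N.src e) e' e →
      ∃ p : List E, p ≠ [] ∧ IsDirPath N.src N.tgt (N.src e') (N.src e) p := by
    intro e' e h
    have single : ∀ a b : E, N.tgt a = N.src b →
        IsDirPath N.src N.tgt (N.src a) (N.src b) [a] := by
      intro a b hab
      rw [← hab]
      exact IsDirPath.cons a (IsDirPath.nil _)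
    induction h with
    | single h => exact ⟨[e'], by simp, single _ _ h⟩
    | tail _ h ih =>
      obtain ⟨p, hp, hq⟩ := ih
      exact ⟨p ++ _, by simp [hp], hq.append (single _ _ h)⟩
  have : Std.Irrefl (Relation.TransGen (fun e' e : E => N.tgt e' = N.src e)) :=
    ⟨fun e he => by
      obtain ⟨p, hp, hq⟩ := key e e he
      exact hp (N.acyclic _ _ hq)⟩
  exact Subrelation.wf (r := Relation.TransGen (fun e' e : E => N.tgt e' = N.src e))
    (fun h => Relation.TransGen.single h) (Finite.wellFounded_of_trans_of_irrefl
      (Relation.TransGen (fun e' e : E => N.tgt e' = N.src e)))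

/-- A `(k, n)` network code over the alphabet `A` for computing a function with values in `B`. The
encoding function of an edge out of `v` takes the vectors on the in-edges of `v` and, if `v` is a
source, also the message vector of `v`: the index type `{i // source i = v}` has exactly one element
if `v` is a source and is empty otherwise. (The receiver has no out-edges, by acyclicity.) -/
structure Code {V E : Type*} (N : Network V E) (A B : Type*) (k n : ℕ) where
  /-- the encoding function of each edge -/
  encode : ∀ e : E, (N.InEdge (N.src e) → Fin n → A) →
    ({i : Fin N.numSources // N.source i = N.src e} → Fin k → A) → Fin n → A
  /-- the decoding function of the receiver -/
  decode : (N.InEdge N.receiver → Fin n → A) → Fin k → B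

/-- The vector carried by each edge when the sources generate the message vectors `α`. -/
noncomputable def Code.edgeVec {V E : Type*} [Finite E] {N : Network V E} {A B : Type*} {k n : ℕ}
    (c : N.Code A B k n) (α : Fin N.numSources → Fin k → A) : E → Fin n → A :=
  N.wellFounded_edge.fix fun e z => c.encode e (fun e' => z e'.1 e'.2) (fun i => α i.1)

theorem Code.edgeVec_eq {V E : Type*} [Finite E] {N : Network V E} {A B : Type*} {k n : ℕ}
    (c : N.Code A B k n) (α : Fin N.numSources → Fin k → A) (e : E) :
    c.edgeVec α e = c.encode e (fun e' => c.edgeVec α e'.1) (fun i => α i.1) :=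
  N.wellFounded_edge.fix_eq _ e

/-- The code lets the receiver compute `f` componentwise, for all messages. -/
def Code.IsSolution {V E : Type*} [Finite E] {N : Network V E} {A B : Type*} {k n : ℕ}
    (c : N.Code A B k n) (f : (Fin N.numSources → A) → B) : Prop :=
  ∀ (α : Fin N.numSources → Fin k → A) (j : Fin k),
    c.decode (fun e => c.edgeVec α e.1) j = f fun i => α i j

/-- The set of achievable computing rates `k / n`. -/
def achievableRates {V E : Type*} [Finite E] (N : Network V E) {A B : Type*}
    (f : (Fin N.numSources → A) → B) : Set ℝ :=
  {r | ∃ k n : ℕ, 0 < k ∧ 0 < n ∧ (∃ c : N.Code A B k n, c.IsSolution f) ∧ r = (k : ℝ) / n}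

/-- The computing capacity: the supremum of all achievable computing rates. -/
noncomputable def computingCapacity {V E : Type*} [Finite E] (N : Network V E) {A B : Type*}
    (f : (Fin N.numSources → A) → B) : ℝ :=
  sSup (N.achievableRates f)

/-- The edge set `C` separates the `i`-th source from the receiver. -/
def Separates {V E : Type*} (N : Network V E) (C : Finset E) (i : Fin N.numSources) : Prop :=
  ∀ p : List E, IsDirPath N.src N.tgt (N.source i) N.receiver p → ∃ e ∈ p, e ∈ C

/-- The set `I_C` of (indices of) sources that `C` separates from the receiver. -/
def separated {V E : Type*} (N : Network V E) (C : Finset E) : Set (Fin N.numSources) :=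
  {i | N.Separates C i}

/-- A cut separates at least one source from the receiver. -/
def IsCut {V E : Type*} (N : Network V E) (C : Finset E) : Prop :=
  ∃ i, N.Separates C i

/-- The cuts of the network. -/
abbrev Cut {V E : Type*} (N : Network V E) : Type _ := {C : Finset E // N.IsCut C}

/-- A subgraph, given by its nodes and its edges, that contains all sources and the receiver and in
which every source has a directed path to the receiver. -/
structure IsConnecting {V E : Type*} (N : Network V E) (t : Finset V × Finset E) : Prop where
  src_mem : ∀ e ∈ t.2, N.src e ∈ t.1
  tgt_mem : ∀ e ∈ t.2, N.tgt e ∈ t.1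
  source_mem : ∀ i, N.source i ∈ t.1
  receiver_mem : N.receiver ∈ t.1
  exists_path : ∀ i, ∃ p : List E,
    IsDirPath N.src N.tgt (N.source i) N.receiver p ∧ ∀ e ∈ p, e ∈ t.2

/-- The Steiner trees: the minimal such subgraphs, with respect to inclusion of both nodes and
edges. -/
abbrev SteinerTree {V E : Type*} (N : Network V E) : Type _ :=
  {t : Finset V × Finset E // Minimal N.IsConnecting t}

noncomputable instance {V E : Type*} [Finite V] [Finite E] (N : Network V E) :
    Fintype N.SteinerTree :=
  Fintype.ofFinite _

open Classical in
/-- A fractional packing of Steiner trees: nonnegative weights, of total at most one on the trees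
through any given edge. -/
def IsFractionalPacking {V E : Type*} [Finite V] [Finite E] (N : Network V E)
    (u : N.SteinerTree → ℝ) : Prop :=
  (∀ t, 0 ≤ u t) ∧ ∀ e : E, ∑ t with e ∈ t.1.2, u t ≤ 1

/-- The fractional Steiner tree packing number, the value of a linear program. The supremum is a
maximum, see `isGreatest_steinerNumber`. -/
noncomputable def steinerNumber {V E : Type*} [Finite V] [Finite E] (N : Network V E) : ℝ :=
  sSup {r | ∃ u : N.SteinerTree → ℝ, N.IsFractionalPacking u ∧ r = ∑ t, u t}

end Network

/-- The target function depends on each of its arguments. -/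
def DependsOnAll {s : ℕ} {A B : Type*} (f : (Fin s → A) → B) : Prop :=
  ∀ i, ∃ x y : Fin s → A, (∀ j, j ≠ i → x j = y j) ∧ f x ≠ f y

/-- The equivalence relation on `A^I` induced by `f`: `a ≡ b` if `f x = f y` whenever `x` restricts
to `a` and `y` to `b` on `I`, and `x` and `y` agree outside `I`. -/
def footprintSetoid {s : ℕ} {A B : Type*} (f : (Fin s → A) → B) (I : Set (Fin s)) :
    Setoid (I → A) where
  r a b := ∀ x y : Fin s → A, (∀ i : I, x i = a i) → (∀ i : I, y i = b i) →
    (∀ j, j ∉ I → x j = y j) → f x = f y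
  iseqv :=
    { refl := fun a x y hx hy h => by
        congr 1
        funext j
        by_cases hj : j ∈ I
        · exact (hx ⟨j, hj⟩).trans (hy ⟨j, hj⟩).symm
        · exact h j hj
      symm := fun h x y hx hy hxy => (h y x hy hx fun j hj => (hxy j hj).symm).symm
      trans := fun {a b c} hab hbc x y hx hy hxy => by
        classical
        have h1 := hab x (fun j => if hj : j ∈ I then b ⟨j, hj⟩ else x j) hx
          (fun i => by simp) (fun j hj => by simp [hj])
        have h2 := hbc (fun j => if hj : j ∈ I then b ⟨j, hj⟩ else x j) y
          (fun i => by simp) hy (fun j hj => by simp [hj, hxy j hj])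
        exact h1.trans h2 }

/-- The footprint size `R_{I,f}`: the number of equivalence classes. -/
noncomputable def footprintSize {s : ℕ} {A B : Type*} (f : (Fin s → A) → B)
    (I : Set (Fin s)) : ℕ :=
  Nat.card (Quotient (footprintSetoid f I))

/-! The suprema and infima above and in the theorem never take a default value. -/

namespace Network

theorem numSources_pos {V E : Type*} [Finite E] (N : Network V E) : 0 < N.numSources := by
  by_contra h0
  have hin : ∀ v : V, ∃ e : E, N.tgt e = v := by
    intro v
    by_contra hv
    push Not at hv
    obtain ⟨i, -⟩ := N.source_of_no_inEdge v hv
    exact h0 (Nat.lt_of_le_of_lt (Nat.zero_le _) i.2)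
  obtain ⟨e0, -⟩ := hin N.receiver
  obtain ⟨e, -, he⟩ := N.wellFounded_edge.has_min Set.univ ⟨e0, trivial⟩
  obtain ⟨e', he'⟩ := hin (N.src e)
  exact he e' trivial he'

theorem path_ne_nil {V E : Type*} (N : Network V E) (i : Fin N.numSources) {p : List E}
    (hp : IsDirPath N.src N.tgt (N.source i) N.receiver p) : p ≠ [] := by
  rintro rfl
  generalize hv : N.source i = v at hp
  generalize hw : N.receiver = w at hp
  cases hp
  exact N.source_ne_receiver i (hv.trans hw.symm)

/-- The set of all edges is a cut. -/
instance {V E : Type*} [Finite E] (N : Network V E) : Nonempty N.Cut := by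
  have := Fintype.ofFinite E
  refine ⟨⟨Finset.univ, ⟨0, N.numSources_pos⟩, fun p hp => ?_⟩⟩
  obtain ⟨e, he⟩ := List.exists_mem_of_ne_nil p (N.path_ne_nil _ hp)
  exact ⟨e, he, Finset.mem_univ e⟩

theorem two_le_footprintSize {V E : Type*} (N : Network V E) {A B : Type*} [Finite A]
    {f : (Fin N.numSources → A) → B} (hf : DependsOnAll f) (C : N.Cut) :
    2 ≤ footprintSize f (N.separated C.1) := by
  obtain ⟨C, i, hi⟩ := C
  obtain ⟨x, y, hxy, hne⟩ := hf i
  have : Nontrivial (Quotient (footprintSetoid f (N.separated C))) := by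
    refine ⟨⟨Quotient.mk _ fun j => x j, Quotient.mk _ fun j => y j, fun h => hne ?_⟩⟩
    refine (Quotient.exact h) x y (fun _ => rfl) (fun _ => rfl) fun j hj => hxy j ?_
    rintro rfl
    exact hj hi
  exact Finite.one_lt_card

theorem bddAbove_achievableRates {V E : Type*} [Finite E] (N : Network V E) {A B : Type*}
    [Finite A] {f : (Fin N.numSources → A) → B} (hf : DependsOnAll f) :
    BddAbove (N.achievableRates f) := by
  obtain ⟨x, y, -, hne⟩ := hf ⟨0, N.numSources_pos⟩
  refine ⟨(Nat.card A * Nat.card (N.InEdge N.receiver) : ℕ), ?_⟩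
  rintro r ⟨k, n, -, hn, ⟨c, hc⟩, rfl⟩
  let α : (Fin k → Bool) → Fin N.numSources → Fin k → A :=
    fun b i j => if b j then x i else y i
  have hinj : Function.Injective
      (fun (b : Fin k → Bool) (e : N.InEdge N.receiver) => c.edgeVec (α b) e.1) := by
    intro b b' h
    funext j
    have h1 := hc (α b) j
    have h2 := hc (α b') j
    have h3 : f (fun i => α b i j) = f (fun i => α b' i j) := by
      rw [← h1, ← h2]
      exact congrFun (congrArg c.decode h) j
    cases hb : b j <;> cases hb' : b' j <;> simp only [α, hb, hb'] at h3 ⊢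
    · exact absurd h3.symm hne
    · exact absurd h3 hne
  have hcard := Nat.card_le_card_of_injective _ hinj
  have hb : Nat.card (Fin k → Bool) = 2 ^ k := by simp
  have hA : Nat.card (N.InEdge N.receiver → Fin n → A) =
      (Nat.card A ^ n) ^ Nat.card (N.InEdge N.receiver) := by
    rw [Nat.card_fun, Nat.card_fun, Nat.card_fin]
  rw [hb, hA] at hcard
  have h2 : 2 ^ k ≤ 2 ^ (Nat.card A * n * Nat.card (N.InEdge N.receiver)) := by
    refine hcard.trans ?_
    rw [pow_mul, pow_mul]
    gcongr
    exact (Nat.lt_two_pow_self).le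
  have h3 := (Nat.pow_le_pow_iff_right (by norm_num)).1 h2
  rw [div_le_iff₀ (by exact_mod_cast hn)]
  exact_mod_cast h3.trans (le_of_eq (by ring))

/-- The linear program of `steinerNumber` has an optimal solution. -/
theorem isGreatest_steinerNumber {V E : Type*} [Finite V] [Finite E] (N : Network V E) :
    IsGreatest {r | ∃ u : N.SteinerTree → ℝ, N.IsFractionalPacking u ∧ r = ∑ t, u t}
      N.steinerNumber := by
  classical
  have himg : {r | ∃ u : N.SteinerTree → ℝ, N.IsFractionalPacking u ∧ r = ∑ t, u t} =
      (fun u : N.SteinerTree → ℝ => ∑ t, u t) '' {u | N.IsFractionalPacking u} := by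
    ext r
    simp [eq_comm]
  have hcomp : IsCompact {u : N.SteinerTree → ℝ | N.IsFractionalPacking u} := by
    refine (isCompact_univ_pi fun _ => isCompact_Icc (a := (0 : ℝ)) (b := 1)).of_isClosed_subset
      ?_ ?_
    · simp only [IsFractionalPacking, Set.ofPred_and, Set.ofPred_forall]
      refine IsClosed.inter (isClosed_iInter fun t => isClosed_le (by fun_prop) (by fun_prop))
        (isClosed_iInter fun e => isClosed_le (by fun_prop) (by fun_prop))
    · rintro u ⟨h0, h1⟩ t -
      refine ⟨h0 t, ?_⟩
      obtain ⟨p, hp, hmem⟩ := t.2.prop.exists_path ⟨0, N.numSources_pos⟩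
      obtain ⟨e, he⟩ := List.exists_mem_of_ne_nil p (N.path_ne_nil _ hp)
      refine le_trans ?_ (h1 e)
      exact Finset.single_le_sum (f := u) (fun t _ => h0 t) (by simp [hmem e he])
  unfold steinerNumber
  rw [himg]
  refine (hcomp.image (by fun_prop)).isGreatest_sSup ⟨0, 0, ⟨by simp, by simp⟩, by simp⟩

end Network

/-! Every Steiner tree contains a routing: each node has at most one selected out-edge, and
following these leads every source to the receiver. Along a routing, the edge `e` need not carry the
upstream messages themselves, only their class under the footprint equivalence. Classes on disjoint
sets of arguments combine (`FootprintRel.union`), so each edge can compute its class from the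
in-edges and the local message, and at the receiver the class determines the value of `f`.

The sources upstream of `e`, if any, form the set separated by some cut
(`exists_separated_eq_upstream`), so `e` carries at most `M` classes per component, where `M` is the
largest footprint size. If tree `t` handles `k t` components, an edge has room as soon as `M` to the
sum of its `k t` is at most `|A| ^ n`. Rounding down `u t * n / log M` meets this bound for any
fractional packing `u`, and the rounding loss vanishes as `n` grows. -/

/-- The words `x` and `y` have `f`-equivalent restrictions to `I`. -/
def FootprintRel {s : ℕ} {A B : Type*} (f : (Fin s → A) → B) (I : Set (Fin s))
    (x y : Fin s → A) : Prop :=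
  (footprintSetoid f I).r (fun i => x i) (fun i => y i)

/-! ### Combining footprint equivalences -/

namespace FootprintRel

variable {s : ℕ} {A B : Type*} {f : (Fin s → A) → B} {I J : Set (Fin s)} {x y : Fin s → A}

theorem of_eqOn (h : ∀ i ∈ I, x i = y i) : FootprintRel f I x y := by
  have : (fun i : I => x i) = fun i : I => y i := funext fun i => h i i.2
  unfold FootprintRel
  rw [this]

theorem union (hI : FootprintRel f I x y) (hJ : FootprintRel f J x y) (hd : Disjoint I J) :
    FootprintRel f (I ∪ J) x y := by
  classical
  intro z w hz hw hzw
  -- Pass from `z` to `w` through the word that is already `y` on `I` but still `z` elsewhere.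
  refine (hI z (fun i => if i ∈ I then y i else z i) (fun i => hz ⟨i, Or.inl i.2⟩)
    (fun i => by simp) (fun j hj => by simp [hj])).trans
    (hJ _ w (fun i => ?_) (fun i => hw ⟨i, Or.inr i.2⟩) fun j hj => ?_)
  · have : (i : Fin s) ∉ I := fun h => Set.disjoint_left.1 hd h i.2
    simpa [this] using hz ⟨i, Or.inr i.2⟩
  · by_cases hjI : j ∈ I
    · simpa [hjI] using (hw ⟨j, Or.inl hjI⟩).symm
    · simpa [hjI] using hzw j (by simp [hj, hjI])

theorem biUnion {ι : Type*} (t : Finset ι) (P : ι → Set (Fin s))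
    (hd : ∀ a b i, i ∈ P a → i ∈ P b → a = b) (h : ∀ a, FootprintRel f (P a) x y) :
    FootprintRel f (⋃ a ∈ t, P a) x y := by
  classical
  induction t using Finset.induction_on with
  | empty => exact of_eqOn (by simp)
  | insert a t ha ih =>
    rw [Finset.set_biUnion_insert]
    refine (h a).union ih (Set.disjoint_left.2 fun i hi hi' => ?_)
    simp only [Set.mem_iUnion, exists_prop] at hi'
    obtain ⟨b, hb, hib⟩ := hi'
    exact ha (hd a b i hi hib ▸ hb)

theorem apply_eq (h : FootprintRel f I x y) (hI : ∀ i, i ∈ I) : f x = f y :=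
  h x y (fun _ => rfl) (fun _ => rfl) fun j hj => absurd (hI j) hj

end FootprintRel

/-! ### Codes from locally computable edge maps -/

namespace Network

variable {V E : Type*}

/-- A family of edge maps that can be computed locally, and from which the target function can be
computed at the receiver, comes from a network code. -/
theorem exists_isSolution_of_edgeMaps [Finite E] (N : Network V E) {A B : Type*} [Nonempty A]
    {k n : ℕ} (f : (Fin N.numSources → A) → B)
    (G : E → (Fin N.numSources → Fin k → A) → Fin n → A)
    (hG : ∀ e α β, (∀ e', N.tgt e' = N.src e → G e' α = G e' β) →
      (∀ i, N.source i = N.src e → α i = β i) → G e α = G e β)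
    (hr : ∀ α β, (∀ e', N.tgt e' = N.receiver → G e' α = G e' β) →
      ∀ j, f (fun i => α i j) = f fun i => β i j) :
    ∃ c : N.Code A B k n, c.IsSolution f := by
  classical
  obtain ⟨a⟩ := ‹Nonempty A›
  let c : N.Code A B k n :=
    { encode := fun e z m =>
        if h : ∃ α, (∀ e' : N.InEdge (N.src e), z e' = G e' α) ∧
          ∀ i : {i // N.source i = N.src e}, m i = α i
        then G e h.choose else fun _ => a
      decode := fun z => if h : ∃ α, ∀ e' : N.InEdge N.receiver, z e' = G e' α
        then fun j => f fun i => h.choose i j else fun _ => f fun _ => a }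
  have hc : ∀ α e, c.edgeVec α e = G e α := by
    intro α e
    induction e using N.wellFounded_edge.induction with
    | _ e ih =>
      rw [c.edgeVec_eq]
      have h : ∃ β, (∀ e' : N.InEdge (N.src e), c.edgeVec α e' = G e' β) ∧
          ∀ i : {i // N.source i = N.src e}, α i = β i :=
        ⟨α, fun e' => ih e' e'.2, fun _ => rfl⟩
      simp only [c] at h ⊢
      rw [dif_pos h]
      refine hG e _ _ (fun e' he' => ?_) fun i hi => (h.choose_spec.2 ⟨i, hi⟩).symm
      exact (h.choose_spec.1 ⟨e', he'⟩).symm.trans (ih e' he')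
  refine ⟨c, fun α j => ?_⟩
  have h : ∃ β, ∀ e' : N.InEdge N.receiver, c.edgeVec α e' = G e' β := ⟨α, fun e' => hc α e'⟩
  simp only [c] at h ⊢
  rw [dif_pos h]
  exact hr _ _ (fun e' he' => (h.choose_spec ⟨e', he'⟩).symm.trans (hc α e')) j

/-! ### Routings and the cuts behind their edges -/

/-- The node `b` follows the node `a` along an edge in `S`. -/
def Next (N : Network V E) (S : Set E) (a b : V) : Prop :=
  ∃ e ∈ S, N.src e = a ∧ N.tgt e = b

/-- An edge set with at most one edge out of each node along which every source reaches the
receiver. -/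
structure IsRouting (N : Network V E) (S : Set E) : Prop where
  eq_of_src_eq : ∀ e ∈ S, ∀ e' ∈ S, N.src e = N.src e' → e = e'
  reaches : ∀ i, Relation.ReflTransGen (N.Next S) (N.source i) N.receiver

/-- The sources that reach the node `v` along edges in `S`. -/
def upstream (N : Network V E) (S : Set E) (v : V) : Set (Fin N.numSources) :=
  {i | Relation.ReflTransGen (N.Next S) (N.source i) v}

theorem exists_isDirPath_of_reflTransGen (N : Network V E) {S : Set E} {a b : V}
    (h : Relation.ReflTransGen (N.Next S) a b) :
    ∃ p, IsDirPath N.src N.tgt a b p ∧ ∀ e ∈ p, e ∈ S := by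
  induction h using Relation.ReflTransGen.head_induction_on with
  | refl => exact ⟨[], .nil _, by simp⟩
  | head h _ ih =>
    obtain ⟨e, he, rfl, rfl⟩ := h
    obtain ⟨p, hp, hpS⟩ := ih
    exact ⟨e :: p, .cons e hp, by simpa [he] using hpS⟩

theorem not_reflTransGen_tgt_src (N : Network V E) {S : Set E} (e : E) :
    ¬ Relation.ReflTransGen (N.Next S) (N.tgt e) (N.src e) := by
  intro h
  obtain ⟨p, hp, -⟩ := N.exists_isDirPath_of_reflTransGen h
  exact List.cons_ne_nil _ _ (N.acyclic _ _ (IsDirPath.cons e hp))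

/-- A path that leaves a node set contains an edge that leaves it. -/
theorem exists_leaving_edge {src tgt : E → V} {u v : V} {p : List E}
    (hp : IsDirPath src tgt u v p) (X : Set V) (hu : u ∈ X) (hv : v ∉ X) :
    ∃ e ∈ p, src e ∈ X ∧ tgt e ∉ X := by
  induction hp with
  | nil => exact absurd hu hv
  | cons e h ih =>
    by_cases he : tgt e ∈ X
    · obtain ⟨e', h1, h2⟩ := ih he hv
      exact ⟨e', by simp [h1], h2⟩
    · exact ⟨e, by simp, hu, he⟩

theorem mem_upstream_iff (N : Network V E) {S : Set E} {v : V} {i : Fin N.numSources} :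
    i ∈ N.upstream S v ↔
      N.source i = v ∨ ∃ e ∈ S, N.tgt e = v ∧ i ∈ N.upstream S (N.src e) := by
  constructor
  · intro h
    rcases Relation.ReflTransGen.cases_tail h with h | ⟨w, hw, e, he, rfl, hv⟩
    · exact Or.inl h.symm
    · exact Or.inr ⟨e, he, hv, hw⟩
  · rintro (rfl | ⟨e, he, rfl, h⟩)
    · exact .refl
    · exact Relation.ReflTransGen.tail h ⟨e, he, rfl, rfl⟩

namespace IsRouting

variable {N : Network V E} {S : Set E}

theorem rightUnique (hS : N.IsRouting S) : Relator.RightUnique (N.Next S) := by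
  rintro a b c ⟨e, he, rfl, rfl⟩ ⟨e', he', h, rfl⟩
  rw [hS.eq_of_src_eq e' he' e he h]

/-- The route of a source is unique, so one of the two tails lies on the route from the other. Were
they distinct, the common head would reach the second tail, closing a cycle. Hence distinct in-edges
of a node have disjoint upstream sets. -/
theorem eq_of_mem_upstream (hS : N.IsRouting S) {e e' : E} (he : e ∈ S) (he' : e' ∈ S)
    (ht : N.tgt e = N.tgt e') {i : Fin N.numSources} (hi : i ∈ N.upstream S (N.src e))
    (hi' : i ∈ N.upstream S (N.src e')) : e = e' := by
  have key : ∀ e ∈ S, ∀ e' ∈ S, N.tgt e = N.tgt e' →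
      Relation.ReflTransGen (N.Next S) (N.src e) (N.src e') → e = e' := by
    intro e he e' he' ht h
    rcases Relation.ReflTransGen.cases_head h with h | ⟨w, hw, h⟩
    · exact hS.eq_of_src_eq e he e' he' h
    · rw [← hS.rightUnique ⟨e, he, rfl, rfl⟩ hw, ht] at h
      exact absurd h (N.not_reflTransGen_tgt_src e')
  rcases Relation.ReflTransGen.total_of_right_unique hS.rightUnique hi hi' with h | h
  · exact key e he e' he' ht h
  · exact (key e' he' e he ht.symm h).symm

/-- The sources upstream of an edge of a routing are exactly those separated from the receiver by
some edge set. -/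
theorem exists_separated_eq_upstream [Finite E] (hS : N.IsRouting S) {e : E} (he : e ∈ S)
    (hne : (N.upstream S (N.src e)).Nonempty) :
    ∃ C : N.Cut, N.separated C.1 = N.upstream S (N.src e) := by
  classical
  have := Fintype.ofFinite E
  -- `C` consists of the edges leaving `X`. A source in `X` cannot avoid `C`; the route of a source
  -- outside `X` does, since the tail of an edge of `C` lies in `X` and so would every earlier node.
  let X : Set V := {w | Relation.ReflTransGen (N.Next S) w (N.src e)}
  let C : Finset E := {a | N.src a ∈ X ∧ N.tgt a ∉ X}
  obtain ⟨i₀, hi₀⟩ := hne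
  -- Otherwise `e`, a path from its head to the receiver, and a path from there to its tail would
  -- form a cycle.
  have hρ : N.receiver ∉ X := by
    intro h
    rcases Relation.ReflTransGen.total_of_right_unique hS.rightUnique hi₀ (hS.reaches i₀)
      with h' | h'
    · rcases Relation.ReflTransGen.cases_head h' with h' | ⟨w, hw, h'⟩
      · obtain ⟨p, hp⟩ := N.reaches_receiver (N.tgt e)
        rw [← h'] at hp
        exact List.cons_ne_nil _ _ (N.acyclic _ _ (IsDirPath.cons e hp))
      · rw [← hS.rightUnique ⟨e, he, rfl, rfl⟩ hw] at h'
        exact N.not_reflTransGen_tgt_src e (h'.trans h)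
    · obtain ⟨p, hp⟩ := N.reaches_receiver (N.tgt e)
      obtain ⟨q, hq, -⟩ := N.exists_isDirPath_of_reflTransGen h
      exact List.cons_ne_nil _ _ (N.acyclic _ _ (IsDirPath.cons e (hp.append hq)))
  have hsep : ∀ i, N.Separates C i ↔ i ∈ N.upstream S (N.src e) := by
    intro i
    constructor
    · intro h
      obtain ⟨p, hp, hpS⟩ := N.exists_isDirPath_of_reflTransGen (hS.reaches i)
      obtain ⟨a, hap, haC⟩ := h p hp
      by_contra hi
      have haX : N.src a ∈ X := (Finset.mem_filter.1 haC).2.1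
      have back : ∀ {u w : V} {p : List E}, IsDirPath N.src N.tgt u w p → (∀ e ∈ p, e ∈ S) →
          a ∈ p → u ∈ X := by
        intro u w p hp
        induction hp with
        | nil => simp
        | cons b h ih =>
          intro hpS hap
          rcases List.mem_cons.1 hap with rfl | hap
          · exact haX
          · exact Relation.ReflTransGen.head ⟨b, hpS b (by simp), rfl, rfl⟩
              (ih (fun e he => hpS e (by simp [he])) hap)
      exact hi (back hp hpS hap)
    · intro h p hp
      obtain ⟨a, hap, ha⟩ := exists_leaving_edge hp X h hρ
      exact ⟨a, hap, by simpa [C] using ha⟩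
  exact ⟨⟨C, i₀, (hsep i₀).2 hi₀⟩, Set.ext hsep⟩

theorem footprintSize_upstream_le [Finite E] (hS : N.IsRouting S) {A B : Type*}
    {f : (Fin N.numSources → A) → B} {M : ℕ} (hM0 : 0 < M)
    (hM : ∀ C : N.Cut, footprintSize f (N.separated C.1) ≤ M) {e : E} (he : e ∈ S) :
    footprintSize f (N.upstream S (N.src e)) ≤ M := by
  rcases (N.upstream S (N.src e)).eq_empty_or_nonempty with h | h
  -- A routing may contain edges that no source reaches; they have a single class, whence `hM0`.
  · rw [h]
    refine le_trans ?_ hM0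
    have : Subsingleton ((∅ : Set (Fin N.numSources)) → A) := inferInstance
    have := Quotient.instSubsingletonQuotient (footprintSetoid f ∅)
    exact Finite.card_le_one_iff_subsingleton.2 this
  · obtain ⟨C, hC⟩ := hS.exists_separated_eq_upstream he h
    exact hC ▸ hM C

/-- The class of the messages upstream of a node is determined by the classes on the in-edges and
the message generated at the node. -/
theorem footprintRel_upstream [Finite E] (hS : N.IsRouting S) {A B : Type*}
    {f : (Fin N.numSources → A) → B} {x y : Fin N.numSources → A} (v : V)
    (hin : ∀ e ∈ S, N.tgt e = v → FootprintRel f (N.upstream S (N.src e)) x y)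
    (hsrc : ∀ i, N.source i = v → x i = y i) :
    FootprintRel f (N.upstream S v) x y := by
  classical
  have := Fintype.ofFinite E
  let P : E → Set (Fin N.numSources) :=
    fun e => {i | e ∈ S ∧ N.tgt e = v ∧ i ∈ N.upstream S (N.src e)}
  -- A disjoint decomposition; `P e` is empty unless `e` is a selected in-edge of `v`.
  have hU : N.upstream S v = {i | N.source i = v} ∪ ⋃ e ∈ (Finset.univ : Finset E), P e := by
    ext i
    rw [mem_upstream_iff]
    simp [P]
  rw [hU]
  refine FootprintRel.union (FootprintRel.of_eqOn hsrc)
    (FootprintRel.biUnion _ P ?_ fun e => ?_) (Set.disjoint_left.2 ?_)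
  · rintro a b i ⟨ha, hav, hai⟩ ⟨hb, hbv, hbi⟩
    exact hS.eq_of_mem_upstream ha hb (hav.trans hbv.symm) hai hbi
  · by_cases he : e ∈ S ∧ N.tgt e = v
    · have : P e = N.upstream S (N.src e) := by
        ext i
        simp [P, he.1, he.2]
      exact this ▸ hin e he.1 he.2
    · exact FootprintRel.of_eqOn fun i hi => absurd ⟨hi.1, hi.2.1⟩ he
  · rintro i (rfl : N.source i = v) hi
    simp only [Set.mem_iUnion] at hi
    obtain ⟨e, -, -, het, hi⟩ := hi
    have hi' : Relation.ReflTransGen (N.Next S) (N.source i) (N.src e) := hi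
    rw [← het] at hi'
    exact N.not_reflTransGen_tgt_src e hi'

end IsRouting

/-! ### Extracting a routing by shortest paths -/

/-- Every connecting subgraph contains a routing. -/
theorem IsConnecting.exists_isRouting {N : Network V E} {t : Finset V × Finset E}
    (ht : N.IsConnecting t) : ∃ S : Set E, (∀ e ∈ S, e ∈ t.2) ∧ N.IsRouting S := by
  classical
  let D : V → ℕ → Prop := fun v m =>
    ∃ p, IsDirPath N.src N.tgt v N.receiver p ∧ (∀ e ∈ p, e ∈ t.2) ∧ p.length ≤ m
  have step : ∀ v m, v ≠ N.receiver → D v m →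
      ∃ e ∈ t.2, N.src e = v ∧ ∃ l < m, D (N.tgt e) l := by
    rintro v m hv ⟨p, hp, hpt, hl⟩
    cases hp with
    | nil => exact absurd rfl hv
    | @cons e _ p h =>
      exact ⟨e, hpt e (by simp), rfl, p.length, by simpa using hl,
        p, h, fun a ha => hpt a (by simp [ha]), le_rfl⟩
  -- The first edge of a shortest path lowers every bound on the distance to the receiver, so one
  -- choice of edge per node serves all `m`.
  have best : ∀ v : {v // v ≠ N.receiver ∧ ∃ m, D v m},
      ∃ e ∈ t.2, N.src e = v ∧ ∀ m, D v m → ∃ l < m, D (N.tgt e) l := by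
    rintro ⟨v, hv, hm⟩
    obtain ⟨e, he, hsrc, l, hl, hD⟩ := step v _ hv (Nat.find_spec hm)
    exact ⟨e, he, hsrc, fun m hm' => ⟨l, hl.trans_le (Nat.find_min' hm hm'), hD⟩⟩
  choose g hgt hgs hg using best
  have reach : ∀ m v, D v m →
      Relation.ReflTransGen (N.Next (Set.range g)) v N.receiver := by
    intro m
    induction m using Nat.strong_induction_on with
    | _ m ih =>
      intro v hD
      by_cases hv : v = N.receiver
      · rw [hv]
      · obtain ⟨l, hl, hD'⟩ := hg ⟨v, hv, m, hD⟩ m hD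
        exact Relation.ReflTransGen.head ⟨_, ⟨_, rfl⟩, hgs _, rfl⟩ (ih l hl _ hD')
  refine ⟨Set.range g, ?_, ?_, fun i => ?_⟩
  · rintro _ ⟨v, rfl⟩
    exact hgt v
  · rintro _ ⟨v, rfl⟩ _ ⟨w, rfl⟩ h
    rw [hgs, hgs] at h
    rw [Subtype.ext h]
  · obtain ⟨p, hp, hpt⟩ := ht.exists_path i
    exact reach p.length _ ⟨p, hp, hpt, le_rfl⟩

/-! ### Sharing edges among routings, and rounding -/

open Classical in
/-- Sharing the edges among several routings, the `t`-th one of which is used to compute `k t`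
components of the target function. -/
theorem exists_isSolution_of_isRouting [Finite E] (N : Network V E) {A B : Type*} [Finite A]
    [Nonempty A] (f : (Fin N.numSources → A) → B) {T : Type*} [Fintype T] (S : T → Set E)
    (hS : ∀ t, N.IsRouting (S t)) (k : T → ℕ) {M n : ℕ} (hM0 : 0 < M)
    (hM : ∀ C : N.Cut, footprintSize f (N.separated C.1) ≤ M)
    (hn : ∀ e, M ^ (∑ t with e ∈ S t, k t) ≤ Nat.card A ^ n) :
    ∃ c : N.Code A B (∑ t, k t) n, c.IsSolution f := by
  let φ : Fin (∑ t, k t) ≃ Σ t, Fin (k t) := (Fintype.equivFinOfCardEq (by simp)).symm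
  -- `Q e` is the content of the edge: one class for each component handled by each routing through
  -- it.
  let Q : E → Type _ := fun e => ∀ t : {t // e ∈ S t}, Fin (k t) →
    Quotient (footprintSetoid f (N.upstream (S t) (N.src e)))
  have emb : ∀ e, Nonempty (Q e ↪ (Fin n → A)) := by
    intro e
    have := Fintype.ofFinite (Q e)
    have := Fintype.ofFinite (Fin n → A)
    rw [Function.Embedding.nonempty_iff_card_le, ← Nat.card_eq_fintype_card,
      ← Nat.card_eq_fintype_card, Nat.card_fun, Nat.card_fin]
    refine le_trans ?_ (hn e)
    rw [Nat.card_pi]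
    calc _ ≤ ∏ t : {t // e ∈ S t}, M ^ k t := by
          refine Finset.prod_le_prod' fun t _ => ?_
          rw [Nat.card_fun, Nat.card_fin]
          exact Nat.pow_le_pow_left ((hS t).footprintSize_upstream_le hM0 hM t.2) _
      _ = M ^ (∑ t : {t // e ∈ S t}, k t) := Finset.prod_pow_eq_pow_sum _ _ _
      _ = _ := by
          congr 1
          exact (Finset.sum_subtype _ (by simp) k).symm
  let J : ∀ e, Q e ↪ (Fin n → A) := fun e => (emb e).some
  let q : ∀ e, (Fin N.numSources → Fin (∑ t, k t) → A) → Q e :=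
    fun e α t j => Quotient.mk _ fun i => α i (φ.symm ⟨t, j⟩)
  have rel_of_eq : ∀ (t : T) (j : Fin (k t)) (v : V) (α β : Fin N.numSources → _ → A),
      (∀ e, N.tgt e = v → J e (q e α) = J e (q e β)) → (∀ i, N.source i = v → α i = β i) →
      FootprintRel f (N.upstream (S t) v) (fun i => α i (φ.symm ⟨t, j⟩))
        fun i => β i (φ.symm ⟨t, j⟩) := by
    intro t j v α β hin hsrc
    refine (hS t).footprintRel_upstream v (fun e he hev => ?_) fun i hi => by rw [hsrc i hi]
    have h := congrFun (congrFun ((J e).injective (hin e hev)) ⟨t, he⟩) j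
    exact Quotient.exact h
  refine N.exists_isSolution_of_edgeMaps f (fun e α => J e (q e α)) ?_ ?_
  · intro e α β hin hsrc
    refine congrArg (J e) (funext fun t => funext fun j => Quotient.sound ?_)
    exact rel_of_eq t j _ α β hin hsrc
  · intro α β hin j
    have h := rel_of_eq (φ j).1 (φ j).2 N.receiver α β hin
      fun i hi => absurd hi (N.source_ne_receiver i)
    simpa using h.apply_eq (hS _).reaches

/-- Rounding down a fractional packing of Steiner trees to an actual network code. -/
theorem sub_le_computingCapacity [Finite V] [Finite E] (N : Network V E) {A B : Type*} [Finite A]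
    [Nontrivial A] {f : (Fin N.numSources → A) → B} (hf : DependsOnAll f) {M : ℕ} (hM2 : 2 ≤ M)
    (hM : ∀ C : N.Cut, footprintSize f (N.separated C.1) ≤ M) {u : N.SteinerTree → ℝ}
    (hu : N.IsFractionalPacking u) {n : ℕ} (hn : 0 < n) :
    (∑ t, u t) / Real.logb (Nat.card A) M - Fintype.card N.SteinerTree / n ≤
      N.computingCapacity f := by
  classical
  have hq : (1 : ℝ) < Nat.card A := by exact_mod_cast Finite.one_lt_card (α := A)
  have hMr : (1 : ℝ) < M := by exact_mod_cast hM2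
  set L := Real.logb (Nat.card A) M with hLdef
  have hL : 0 < L := Real.logb_pos hq hMr
  have hn' : (0 : ℝ) < n := by exact_mod_cast hn
  choose S hSt hS using fun t : N.SteinerTree => t.2.prop.exists_isRouting
  let k : N.SteinerTree → ℕ := fun t => ⌊u t * n / L⌋₊
  have hk0 : ∀ t, 0 ≤ u t * n / L := fun t => by have := hu.1 t; positivity
  have hcap : ∀ e, M ^ (∑ t with e ∈ S t, k t) ≤ Nat.card A ^ n := by
    intro e
    have h1 : ((∑ t with e ∈ S t, k t : ℕ) : ℝ) ≤ n / L := by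
      calc ((∑ t with e ∈ S t, k t : ℕ) : ℝ) ≤ ∑ t with e ∈ S t, u t * n / L := by
            push_cast
            exact Finset.sum_le_sum fun t _ => Nat.floor_le (hk0 t)
        _ ≤ ∑ t with e ∈ t.1.2, u t * n / L := by
            refine Finset.sum_le_sum_of_subset_of_nonneg (fun t ht => ?_) fun t _ _ => hk0 t
            simpa using hSt t e (by simpa using ht)
        _ = (∑ t with e ∈ t.1.2, u t) * n / L := by
            rw [Finset.sum_mul, Finset.sum_div]
        _ ≤ 1 * n / L := by
            gcongr
            convert hu.2 e
        _ = n / L := by rw [one_mul]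
    rw [le_div_iff₀ hL] at h1
    have h2 : (M : ℝ) ^ (∑ t with e ∈ S t, k t) ≤ (Nat.card A : ℝ) ^ n := by
      rw [← Real.rpow_natCast, ← Real.rpow_natCast,
        ← Real.rpow_logb (zero_lt_one.trans hq) hq.ne' (zero_lt_one.trans hMr), ← hLdef,
        ← Real.rpow_mul (zero_lt_one.trans hq).le, mul_comm]
      exact Real.rpow_le_rpow_of_exponent_le hq.le h1
    exact_mod_cast h2
  have hsol : ∃ c : N.Code A B (∑ t, k t) n, c.IsSolution f :=
    N.exists_isSolution_of_isRouting f S hS k (by omega) hM (fun e => by convert hcap e)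
  have hlow : (∑ t, u t) / L - Fintype.card N.SteinerTree / n ≤ (∑ t, k t : ℕ) / (n : ℝ) := by
    have h : ∑ t, (u t * n / L - 1) ≤ ∑ t, (k t : ℝ) :=
      Finset.sum_le_sum fun t _ => (Nat.sub_one_lt_floor _).le
    rw [Finset.sum_sub_distrib, ← Finset.sum_div, ← Finset.sum_mul] at h
    simp only [Finset.sum_const, Finset.card_univ, nsmul_eq_mul, mul_one] at h
    rw [le_div_iff₀ hn', sub_mul, div_mul_cancel₀ _ hn'.ne', div_mul_eq_mul_div]
    exact_mod_cast h
  refine hlow.trans ?_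
  -- Zero components do not give an achievable rate; the bound then follows since the capacity is
  -- nonnegative.
  rcases (∑ t, k t).eq_zero_or_pos with h | h
  · rw [h, Nat.cast_zero, zero_div]
    refine Real.sSup_nonneg ?_
    rintro r ⟨a, b, -, -, -, rfl⟩
    positivity
  · exact le_csSup (N.bddAbove_achievableRates hf) ⟨_, n, h, hn, hsol, rfl⟩

end Network

theorem theorem3p5 {V E : Type*} [Finite V] [Finite E] (N : Network V E)
    {A B : Type*} [Finite A] [Nontrivial A]
    (f : (Fin N.numSources → A) → B) (hf : DependsOnAll f) :
    N.computingCapacity f ≥ N.steinerNumber *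
      (⨅ C : N.Cut, 1 / Real.logb (Nat.card A) (footprintSize f (N.separated C.1))) := by
  -- A cut of largest footprint supplies `M`, and its term bounds the infimum from above.
  obtain ⟨C₀, hC₀⟩ := Finite.exists_max fun C : N.Cut => footprintSize f (N.separated C.1)
  obtain ⟨u, hu, hu_eq⟩ := N.isGreatest_steinerNumber.1
  set L := Real.logb (Nat.card A) (footprintSize f (N.separated C₀.1)) with hL
  have hle : N.steinerNumber * (⨅ C : N.Cut,
      1 / Real.logb (Nat.card A) (footprintSize f (N.separated C.1))) ≤ (∑ t, u t) / L := by
    rw [hu_eq, div_eq_mul_one_div]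
    exact mul_le_mul_of_nonneg_left (ciInf_le (Set.finite_range _).bddBelow C₀)
      (Finset.sum_nonneg fun t _ => hu.1 t)
  refine hle.trans ?_
  have hlim : Filter.Tendsto (fun n : ℕ => (∑ t, u t) / L - Fintype.card N.SteinerTree / (n : ℝ))
      Filter.atTop (nhds ((∑ t, u t) / L - 0)) :=
    tendsto_const_nhds.sub (tendsto_const_div_atTop_nhds_zero_nat _)
  rw [sub_zero] at hlim
  refine le_of_tendsto hlim (Filter.eventually_atTop.2 ⟨1, fun n hn => ?_⟩)
  exact N.sub_le_computingCapacity hf (N.two_le_footprintSize hf C₀) hC₀ hu hn
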